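/- A topological space $X$ is called \emph{stably compact} if it is $T_0$, locally compact (every point has a neighbourhood base of compact sets), well-filtered (whenever the intersection of a filtered family of compact saturated sets is contained in an open set $U$, some member of the family is contained in $U$), and every finite intersection of compact saturated subsets of $X$ is compact (including the empty intersection, so that $X$ itself is compact). Here a set is saturated if it is an intersection of open sets. A map between stably compact spaces is called \emph{spectral} if it is continuous and the inverse image of every compact saturated set is compact. Let $\mathsf{StablyComp}$ be the category of stably compact spaces and spectral maps. The \emph{lower Vietoris functor} $\mathcal V:\mathsf{StablyComp}\to\mathsf{StablyComp}$ sends $X$ to the set of all closed subsets of $X$ (including $\varnothing$) with the topology generated by the sets $U^\Diamond=\{A \mid A\cap U\neq\varnothing\}$, $U\subseteq X$ open, and sends $f:X\to Y$ to the map $A\mapsto\overline{f[A]}$. The \emph{lower Vietoris polynomial functors} on $\mathsf{StablyComp}$ are the endofunctors that can be built (up to natural isomorphism) from the grammar $$F ::= F+F \mid F\times F\mid A\mid \mathrm{Id}\mid \mathcal V,$$ where $A$ stands for the constant functor at an object $A$ of $\mathsf{StablyComp}$, and $+$ and $\times$ denote binary coproducts and products of functors, formed pointwise in $\mathsf{StablyComp}$.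 A functor preserves \emph{codirected limits} if it sends limit cones of (small) diagrams indexed by nonempty codirected partially ordered sets to limit cones. \textbf{Theorem.} (a) The lower Vietoris functor $\mathcal V:\mathsf{StablyComp}\to\mathsf{StablyComp}$ preserves codirected limits. (b) Every lower Vietoris polynomial functor $F:\mathsf{StablyComp}\to\mathsf{StablyComp}$ preserves codirected limits. -/

import Mathlib

open CategoryTheory CategoryTheory.Limits Topology

universe u

/-! ### Stably compact spaces and spectral maps -/

section Spaces

variable {X Y Z : Type*} [TopologicalSpace X] [TopologicalSpace Y] [TopologicalSpace Z]

/-- A subset is saturated if it is the intersection of all open sets containing it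
(`nhdsKer s` is that intersection). -/
def IsSaturated (s : Set X) : Prop := nhdsKer s = s

/-- A space is well-filtered if, whenever the intersection of a (nonempty) filtered family of
compact saturated sets is contained in an open set `U`, some member of the family is contained
in `U`. -/
def WellFiltered (X : Type*) [TopologicalSpace X] : Prop :=
  ∀ 𝒬 : Set (Set X), 𝒬.Nonempty → DirectedOn (· ⊇ ·) 𝒬 →
    (∀ Q ∈ 𝒬, IsCompact Q ∧ IsSaturated Q) →
    ∀ U : Set X, IsOpen U → ⋂₀ 𝒬 ⊆ U → ∃ Q ∈ 𝒬, Q ⊆ U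

/-- A space is stably compact if it is T₀, locally compact (every point has a neighbourhood
base of compact sets), well-filtered, and every finite intersection of compact saturated subsets
is compact (the empty intersection being the whole space). -/
class StablyCompactSpace (X : Type*) [TopologicalSpace X] : Prop where
  t0 : T0Space X
  locallyCompact : LocallyCompactSpace X
  wellFiltered : WellFiltered X
  isCompact_sInter : ∀ 𝒬 : Set (Set X), 𝒬.Finite →
    (∀ Q ∈ 𝒬, IsCompact Q ∧ IsSaturated Q) → IsCompact (⋂₀ 𝒬)

/-- A map is spectral if it is continuous and preimages of compact saturated sets are compact. -/
structure IsSpectral (f : X → Y) : Prop where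
  continuous : Continuous f
  isCompact_preimage : ∀ Q : Set Y, IsCompact Q → IsSaturated Q → IsCompact (f ⁻¹' Q)

theorem isSaturated_iff {s : Set X} : IsSaturated s ↔ ∀ x, ∀ y ∈ s, x ⤳ y → x ∈ s := by
  unfold IsSaturated
  rw [Set.Subset.antisymm_iff, and_iff_left subset_nhdsKer]
  simp only [Set.subset_def, mem_nhdsKer_iff_specializes]
  grind

theorem IsSaturated.preimage {f : X → Y} (hf : Continuous f) {s : Set Y} (hs : IsSaturated s) :
    IsSaturated (f ⁻¹' s) := by
  rw [isSaturated_iff] at hs ⊢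
  exact fun x y hy hxy => hs _ _ hy (hxy.map hf)

theorem isSaturated_sInter {𝒬 : Set (Set X)} (h : ∀ Q ∈ 𝒬, IsSaturated Q) :
    IsSaturated (⋂₀ 𝒬) :=
  isSaturated_iff.2 fun x y hy hxy Q hQ => isSaturated_iff.1 (h Q hQ) x y (hy Q hQ) hxy

/-- `x` is a limit of the ultrafilter `𝒰` that specializes to all its limits. -/
def IsTopLimit (𝒰 : Ultrafilter X) (x : X) : Prop :=
  (𝒰 : Filter X) ≤ 𝓝 x ∧ ∀ y, (𝒰 : Filter X) ≤ 𝓝 y → x ⤳ y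

theorem IsTopLimit.mem {𝒰 : Ultrafilter X} {x : X} (h : IsTopLimit 𝒰 x) {Q : Set X}
    (hc : IsCompact Q) (hs : IsSaturated Q) (hQ : Q ∈ 𝒰) : x ∈ Q := by
  obtain ⟨y, hy, hle⟩ := hc.ultrafilter_le_nhds' 𝒰 hQ
  exact isSaturated_iff.1 hs x y hy (h.2 y hle)

theorem StablyCompactSpace.exists_isTopLimit [h : StablyCompactSpace X] (𝒰 : Ultrafilter X) :
    ∃ x, IsTopLimit 𝒰 x := by
  have := h.locallyCompact
  let 𝒬 : Set (Set X) := {Q | IsCompact Q ∧ IsSaturated Q ∧ Q ∈ 𝒰}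
  have huniv : Set.univ ∈ 𝒬 := by
    refine ⟨?_, by simp [IsSaturated], Filter.univ_mem⟩
    simpa using h.isCompact_sInter ∅ Set.finite_empty (by simp)
  have hinter : ∀ A ∈ 𝒬, ∀ B ∈ 𝒬, A ∩ B ∈ 𝒬 := by
    rintro A ⟨hA, hA', hA''⟩ B ⟨hB, hB', hB''⟩
    have hall : ∀ Q ∈ ({A, B} : Set (Set X)), IsCompact Q ∧ IsSaturated Q := by
      rintro Q (rfl | rfl)
      exacts [⟨hA, hA'⟩, ⟨hB, hB'⟩]
    rw [← Set.sInter_pair]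
    refine ⟨h.isCompact_sInter _ (by simp) hall, isSaturated_sInter fun Q hQ => (hall Q hQ).2, ?_⟩
    rw [Set.sInter_pair]
    exact Filter.inter_mem hA'' hB''
  let U : Set X := ⋃₀ {V | IsOpen V ∧ V ∉ 𝒰}
  have hU : IsOpen U := isOpen_sUnion fun V hV => hV.1
  have hnot : ¬ ⋂₀ 𝒬 ⊆ U := by
    intro hsub
    obtain ⟨Q, hQ, hQU⟩ := h.wellFiltered 𝒬 ⟨_, huniv⟩
      (fun A hA B hB => ⟨A ∩ B, hinter A hA B hB, Set.inter_subset_left, Set.inter_subset_right⟩)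
      (fun Q hQ => ⟨hQ.1, hQ.2.1⟩) U hU hsub
    obtain ⟨x, hx, hle⟩ := hQ.1.ultrafilter_le_nhds' 𝒰 hQ.2.2
    obtain ⟨V, ⟨hVo, hV⟩, hxV⟩ := hQU hx
    exact hV (hle (hVo.mem_nhds hxV))
  obtain ⟨x, hx, hxU⟩ := Set.not_subset.1 hnot
  refine ⟨x, ?_, fun y hy => ?_⟩
  · rw [(nhds_basis_opens x).ge_iff]
    rintro V ⟨hxV, hV⟩
    by_contra hV'
    exact hxU ⟨V, ⟨hV, hV'⟩, hxV⟩
  · rw [specializes_iff_forall_open]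
    intro V hV hyV
    obtain ⟨K, hK, hKV, hKc⟩ := local_compact_nhds (hV.mem_nhds hyV)
    exact nhdsKer_minimal hKV hV
      (hx _ ⟨hKc.nhdsKer, nhdsKer_nhdsKer K, Filter.mem_of_superset (hy hK) subset_nhdsKer⟩)

theorem stablyCompactSpace_of_isTopLimit (h0 : T0Space X) (hl : LocallyCompactSpace X)
    (h : ∀ 𝒰 : Ultrafilter X, ∃ x, IsTopLimit 𝒰 x) : StablyCompactSpace X where
  t0 := h0
  locallyCompact := hl
  wellFiltered 𝒬 hne hdir hQ U hU hsub := by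
    by_contra! hcon
    let B : Filter X := ⨅ Q : 𝒬, Filter.principal (Q.1 ∩ Uᶜ)
    have : Nonempty 𝒬 := hne.to_subtype
    have hB : B.NeBot := by
      refine Filter.iInf_neBot_of_directed' ?_ fun Q => ?_
      · rintro ⟨P, hP⟩ ⟨Q, hQ⟩
        obtain ⟨R, hR, hRP, hRQ⟩ := hdir P hP Q hQ
        refine ⟨⟨R, hR⟩, ?_, ?_⟩ <;>
          exact Filter.principal_mono.2 (Set.inter_subset_inter_left _ ‹_›)
      · rw [Filter.principal_neBot_iff]
        obtain ⟨x, hx, hxU⟩ := Set.not_subset.1 (hcon Q.1 Q.2)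
        exact ⟨x, hx, hxU⟩
    let 𝒰 := Ultrafilter.of B
    have hmem : ∀ Q ∈ 𝒬, Q ∩ Uᶜ ∈ 𝒰 := fun Q hQ =>
      Ultrafilter.of_le B (Filter.mem_iInf_of_mem (⟨Q, hQ⟩ : 𝒬) (Filter.mem_principal_self _))
    obtain ⟨x, hx⟩ := h 𝒰
    have hxU : x ∈ U := hsub fun Q hQ' => hx.mem (hQ Q hQ').1 (hQ Q hQ').2
      (Filter.mem_of_superset (hmem Q hQ') Set.inter_subset_left)
    obtain ⟨Q, hQ'⟩ := hne
    exact Ultrafilter.compl_mem_iff_notMem.1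
      (Filter.mem_of_superset (hmem Q hQ') Set.inter_subset_right) (hx.1 (hU.mem_nhds hxU))
  isCompact_sInter 𝒬 _ hQ := by
    rw [isCompact_iff_ultrafilter_le_nhds']
    intro 𝒰 h𝒰
    obtain ⟨x, hx⟩ := h 𝒰
    exact ⟨x, fun Q hQ' => hx.mem (hQ Q hQ').1 (hQ Q hQ').2
      (Filter.mem_of_superset h𝒰 (Set.sInter_subset_of_mem hQ')), hx.1⟩

theorem isSpectral_of_isTopLimit {f : X → Y} (hf : Continuous f)
    (h : ∀ 𝒰 : Ultrafilter X, ∃ x, (𝒰 : Filter X) ≤ 𝓝 x ∧ IsTopLimit (𝒰.map f) (f x)) :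
    IsSpectral f where
  continuous := hf
  isCompact_preimage Q hc hs := by
    rw [isCompact_iff_ultrafilter_le_nhds']
    intro 𝒰 h𝒰
    obtain ⟨x, hx, hfx⟩ := h 𝒰
    exact ⟨x, hfx.mem hc hs h𝒰, hx⟩

theorem IsSpectral.isTopLimit_map [StablyCompactSpace X] [hY : StablyCompactSpace Y] {f : X → Y}
    (hf : IsSpectral f) {𝒰 : Ultrafilter X} {x : X} (hx : IsTopLimit 𝒰 x) :
    IsTopLimit (𝒰.map f) (f x) := by
  have := hY.locallyCompact
  refine ⟨(hf.continuous.tendsto x).comp hx.1, fun y hy => ?_⟩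
  rw [specializes_iff_forall_open]
  intro V hV hyV
  obtain ⟨K, hK, hKV, hKc⟩ := local_compact_nhds (hV.mem_nhds hyV)
  have hs : IsSaturated (nhdsKer K) := nhdsKer_nhdsKer K
  refine nhdsKer_minimal hKV hV (hx.mem (hf.isCompact_preimage _ hKc.nhdsKer hs)
    (hs.preimage hf.continuous) (Filter.mem_of_superset (hy hK) ?_))
  exact Set.preimage_mono subset_nhdsKer

theorem isSpectral_id : IsSpectral (id : X → X) := ⟨continuous_id, fun _ h _ => h⟩

theorem IsSpectral.comp {g : Y → Z} {f : X → Y} (hg : IsSpectral g) (hf : IsSpectral f) :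
    IsSpectral (g ∘ f) :=
  ⟨hg.continuous.comp hf.continuous, fun Q hQ hs => hf.isCompact_preimage _
    (hg.isCompact_preimage Q hQ hs) (hs.preimage hg.continuous)⟩

/-! ### Binary products and sums of stably compact spaces -/

theorem isTopLimit_prod {𝒰 : Ultrafilter (X × Y)} {x : X} {y : Y}
    (hx : IsTopLimit (𝒰.map Prod.fst) x) (hy : IsTopLimit (𝒰.map Prod.snd) y) :
    IsTopLimit 𝒰 (x, y) := by
  have key : ∀ p : X × Y, (𝒰 : Filter (X × Y)) ≤ 𝓝 p ↔
      (𝒰.map Prod.fst : Filter X) ≤ 𝓝 p.1 ∧ (𝒰.map Prod.snd : Filter Y) ≤ 𝓝 p.2 := by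
    intro p
    rw [nhds_prod_eq]
    exact Filter.tendsto_prod_iff' (f := (𝒰 : Filter (X × Y))) (s := id)
  refine ⟨(key _).2 ⟨hx.1, hy.1⟩, fun p hp => ?_⟩
  exact (hx.2 _ ((key p).1 hp).1).prod (hy.2 _ ((key p).1 hp).2)

instance StablyCompactSpace.instProd [hX : StablyCompactSpace X] [hY : StablyCompactSpace Y] :
    StablyCompactSpace (X × Y) := by
  have := hX.t0; have := hY.t0; have := hX.locallyCompact; have := hY.locallyCompact
  refine stablyCompactSpace_of_isTopLimit inferInstance inferInstance fun 𝒰 => ?_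
  obtain ⟨x, hx⟩ := exists_isTopLimit (𝒰.map Prod.fst)
  obtain ⟨y, hy⟩ := exists_isTopLimit (𝒰.map Prod.snd)
  exact ⟨(x, y), isTopLimit_prod hx hy⟩

theorem isSpectral_fst [StablyCompactSpace X] [StablyCompactSpace Y] :
    IsSpectral (Prod.fst : X × Y → X) := by
  refine isSpectral_of_isTopLimit continuous_fst fun 𝒰 => ?_
  obtain ⟨x, hx⟩ := StablyCompactSpace.exists_isTopLimit (𝒰.map Prod.fst)
  obtain ⟨y, hy⟩ := StablyCompactSpace.exists_isTopLimit (𝒰.map Prod.snd)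
  exact ⟨(x, y), (isTopLimit_prod hx hy).1, hx⟩

theorem isSpectral_snd [StablyCompactSpace X] [StablyCompactSpace Y] :
    IsSpectral (Prod.snd : X × Y → Y) := by
  refine isSpectral_of_isTopLimit continuous_snd fun 𝒰 => ?_
  obtain ⟨x, hx⟩ := StablyCompactSpace.exists_isTopLimit (𝒰.map Prod.fst)
  obtain ⟨y, hy⟩ := StablyCompactSpace.exists_isTopLimit (𝒰.map Prod.snd)
  exact ⟨(x, y), (isTopLimit_prod hx hy).1, hy⟩

theorem IsSpectral.prodMk [StablyCompactSpace X] [StablyCompactSpace Y] [StablyCompactSpace Z]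
    {f : Z → X} {g : Z → Y} (hf : IsSpectral f) (hg : IsSpectral g) :
    IsSpectral fun z => (f z, g z) := by
  refine isSpectral_of_isTopLimit (hf.continuous.prodMk hg.continuous) fun 𝒰 => ?_
  obtain ⟨z, hz⟩ := StablyCompactSpace.exists_isTopLimit 𝒰
  exact ⟨z, hz.1, isTopLimit_prod (hf.isTopLimit_map hz) (hg.isTopLimit_map hz)⟩

theorem IsTopLimit.map_isOpenEmbedding {f : X → Y} (ho : IsOpenEmbedding f)
    (hc : IsClosed (Set.range f)) {𝒰 : Ultrafilter X} {x : X} (hx : IsTopLimit 𝒰 x) :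
    IsTopLimit (𝒰.map f) (f x) := by
  refine ⟨(ho.continuous.tendsto x).comp hx.1, fun y hy => ?_⟩
  have hyr : y ∈ Set.range f := hc.mem_of_frequently_of_tendsto (b := (𝒰 : Filter X)) (f := f)
    (Filter.Frequently.of_forall fun z => ⟨z, rfl⟩) hy
  obtain ⟨z, rfl⟩ := hyr
  refine (hx.2 z ?_).map ho.continuous
  exact (ho.isInducing.tendsto_nhds_iff (f := (id : X → X)) (l := (𝒰 : Filter X))).2 hy

instance StablyCompactSpace.instSum [hX : StablyCompactSpace X] [hY : StablyCompactSpace Y] :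
    StablyCompactSpace (X ⊕ Y) := by
  have := hX.t0; have := hY.t0; have := hX.locallyCompact; have := hY.locallyCompact
  refine stablyCompactSpace_of_isTopLimit ?_ ?_ fun 𝒰 => ?_
  · refine ⟨fun a b hab => ?_⟩
    have hcl : ∀ (x : X) (y : Y), ¬ Inseparable (Sum.inl x : X ⊕ Y) (Sum.inr y) := fun x y h => by
      have := (h.mem_open_iff (isOpen_range_inl (X := X) (Y := Y))).1 ⟨x, rfl⟩
      simp at this
    rcases a with a | a <;> rcases b with b | b
    · exact congrArg Sum.inl (IsInducing.inseparable_iff IsEmbedding.inl.isInducing |>.1 hab).eq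
    · exact (hcl _ _ hab).elim
    · exact (hcl _ _ hab.symm).elim
    · exact congrArg Sum.inr (IsInducing.inseparable_iff IsEmbedding.inr.isInducing |>.1 hab).eq
  · refine ⟨fun a n hn => ?_⟩
    rcases a with a | a
    · obtain ⟨K, hK, hKn, hKc⟩ := local_compact_nhds (continuous_inl.continuousAt hn)
      exact ⟨Sum.inl '' K, IsOpenEmbedding.inl.isOpenMap.image_mem_nhds hK,
        Set.image_subset_iff.2 hKn, hKc.image continuous_inl⟩
    · obtain ⟨K, hK, hKn, hKc⟩ := local_compact_nhds (continuous_inr.continuousAt hn)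
      exact ⟨Sum.inr '' K, IsOpenEmbedding.inr.isOpenMap.image_mem_nhds hK,
        Set.image_subset_iff.2 hKn, hKc.image continuous_inr⟩
  · have : Set.range Sum.inl ∪ Set.range Sum.inr ∈ 𝒰 := by
      rw [Set.range_inl_union_range_inr]; exact Filter.univ_mem
    rcases Ultrafilter.union_mem_iff.1 this with h | h
    · obtain ⟨x, hx⟩ := exists_isTopLimit (𝒰.comap Sum.inl_injective h)
      have := hx.map_isOpenEmbedding (f := (Sum.inl : X → X ⊕ Y)) IsOpenEmbedding.inl
        isClosed_range_inl
      refine ⟨Sum.inl x, ?_⟩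
      convert this
      exact Ultrafilter.coe_injective (by simp [Filter.map_comap_of_mem h])
    · obtain ⟨x, hx⟩ := exists_isTopLimit (𝒰.comap Sum.inr_injective h)
      have := hx.map_isOpenEmbedding (f := (Sum.inr : Y → X ⊕ Y)) IsOpenEmbedding.inr
        isClosed_range_inr
      refine ⟨Sum.inr x, ?_⟩
      convert this
      exact Ultrafilter.coe_injective (by simp [Filter.map_comap_of_mem h])

theorem isSpectral_inl : IsSpectral (Sum.inl : X → X ⊕ Y) :=
  ⟨continuous_inl, fun _ h _ => IsClosedEmbedding.inl.isCompact_preimage h⟩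

theorem isSpectral_inr : IsSpectral (Sum.inr : Y → X ⊕ Y) :=
  ⟨continuous_inr, fun _ h _ => IsClosedEmbedding.inr.isCompact_preimage h⟩

theorem IsSpectral.sumElim {f : X → Z} {g : Y → Z} (hf : IsSpectral f) (hg : IsSpectral g) :
    IsSpectral (Sum.elim f g) := by
  refine ⟨hf.continuous.sumElim hg.continuous, fun Q hc hs => ?_⟩
  convert ((hf.isCompact_preimage Q hc hs).image continuous_inl).union
    ((hg.isCompact_preimage Q hc hs).image (continuous_inr (X := X))) using 1
  ext (x | x) <;> simp

/-! ### The lower Vietoris space -/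

/-- The set of closed subsets of `X` (including the empty one), to be equipped with the lower
Vietoris topology. -/
def LowerVietoris (X : Type*) [TopologicalSpace X] : Type _ := {A : Set X // IsClosed A}

/-- The set `U^◇` of all closed sets that meet `U`. -/
def LowerVietoris.diamond (U : Set X) : Set (LowerVietoris X) := {A | (A.1 ∩ U).Nonempty}

/-- The lower Vietoris topology, generated by the sets `U^◇` with `U` open. -/
instance LowerVietoris.instTopologicalSpace : TopologicalSpace (LowerVietoris X) :=
  TopologicalSpace.generateFrom {S | ∃ U : Set X, IsOpen U ∧ S = LowerVietoris.diamond U}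

/-- The action of the lower Vietoris construction on maps: `A ↦ closure (f '' A)`. -/
def LowerVietoris.map (f : X → Y) (A : LowerVietoris X) : LowerVietoris Y :=
  ⟨closure (f '' A.1), isClosed_closure⟩

namespace LowerVietoris

theorem isOpen_diamond {U : Set X} (hU : IsOpen U) : IsOpen (diamond U) :=
  TopologicalSpace.isOpen_generateFrom_of_mem ⟨U, hU, rfl⟩

theorem le_nhds_iff {F : Filter (LowerVietoris X)} {A : LowerVietoris X} :
    F ≤ 𝓝 A ↔ ∀ U, IsOpen U → (A.1 ∩ U).Nonempty → diamond U ∈ F := by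
  refine ⟨fun h U hU hA => h ((isOpen_diamond hU).mem_nhds hA), fun h => ?_⟩
  rw [TopologicalSpace.nhds_generateFrom]
  refine le_iInf₂ fun S hS => ?_
  obtain ⟨hA, U, hU, rfl⟩ := hS
  exact Filter.le_principal_iff.2 (h U hU hA)

theorem specializes_iff {A B : LowerVietoris X} : A ⤳ B ↔ B.1 ⊆ A.1 := by
  rw [specializes_iff_pure, le_nhds_iff]
  refine ⟨fun h x hx => ?_, fun h U hU hB => hB.mono (Set.inter_subset_inter_left _ h)⟩
  by_contra hxA
  obtain ⟨y, hy, hy'⟩ : (A.1 ∩ A.1ᶜ).Nonempty := h _ A.2.isOpen_compl ⟨x, hx, hxA⟩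
  exact hy' hy

/-- The largest limit of an ultrafilter of closed sets. -/
def limit (𝒰 : Ultrafilter (LowerVietoris X)) : LowerVietoris X :=
  ⟨{x | ∀ U, IsOpen U → x ∈ U → diamond U ∈ 𝒰}, by
    rw [← isOpen_compl_iff, isOpen_iff_forall_mem_open]
    intro x hx
    simp only [Set.mem_compl_iff, Set.mem_ofPred_eq, not_forall] at hx
    obtain ⟨U, hU, hxU, hU'⟩ := hx
    exact ⟨U, fun y hy hy' => hU' (hy' U hU hy), hU, hxU⟩⟩

theorem isTopLimit_limit (𝒰 : Ultrafilter (LowerVietoris X)) : IsTopLimit 𝒰 (limit 𝒰) := by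
  refine ⟨le_nhds_iff.2 ?_, fun B hB => specializes_iff.2 fun x hx U hU hxU => ?_⟩
  · rintro U hU ⟨x, hx, hxU⟩
    exact hx U hU hxU
  · exact le_nhds_iff.1 hB U hU ⟨x, hx, hxU⟩

theorem limit_inter_nonempty {𝒰 : Ultrafilter (LowerVietoris X)} {K : Set X} (hK : IsCompact K)
    (h : diamond K ∈ 𝒰) : ((limit 𝒰).1 ∩ K).Nonempty := by
  by_contra hcon
  have hcov : ∀ x ∈ K, ∃ U ∈ 𝓝[K] x, diamond U ∉ 𝒰 := by
    intro x hx
    have hx' : x ∉ (limit 𝒰).1 := fun h' => hcon ⟨x, h', hx⟩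
    simp only [limit, Set.mem_ofPred_eq, not_forall] at hx'
    obtain ⟨U, hU, hxU, hU'⟩ := hx'
    exact ⟨U, mem_nhdsWithin_of_mem_nhds (hU.mem_nhds hxU), hU'⟩
  refine hK.induction_on (p := fun S => diamond S ∉ 𝒰) ?_ ?_ ?_ hcov h
  · have : diamond (∅ : Set X) = ∅ := by ext; simp [diamond]
    rw [this]; exact Ultrafilter.empty_notMem
  · intro s t hst ht hs
    exact ht (Filter.mem_of_superset hs fun A hA => hA.mono (Set.inter_subset_inter_right _ hst))
  · intro s t hs ht hst
    have : diamond (s ∪ t) = diamond s ∪ diamond t := by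
      ext A; simp [diamond, Set.inter_union_distrib_left]
    rw [this, Ultrafilter.union_mem_iff] at hst
    exact hst.elim hs ht

instance instStablyCompactSpace [hX : StablyCompactSpace X] :
    StablyCompactSpace (LowerVietoris X) := by
  have := hX.locallyCompact
  refine stablyCompactSpace_of_isTopLimit ⟨fun A B h => Subtype.ext ?_⟩ ⟨fun A n hn => ?_⟩
    fun 𝒰 => ⟨_, isTopLimit_limit 𝒰⟩
  · exact (specializes_iff.1 h.specializes').antisymm (specializes_iff.1 h.specializes)
  · obtain ⟨_, ⟨f, ⟨hf, hfs⟩, rfl⟩, hA, hfn⟩ :=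
      (TopologicalSpace.isTopologicalBasis_of_subbasis rfl).mem_nhds_iff.1 hn
    have hK : ∀ S ∈ f, ∃ K : Set X, IsCompact K ∧ A ∈ interior (diamond K) ∧ diamond K ⊆ S := by
      intro S hS
      obtain ⟨U, hU, rfl⟩ := hfs hS
      obtain ⟨x, hxA, hxU⟩ := hA _ hS
      obtain ⟨K, hK, hKU, hKc⟩ := local_compact_nhds (hU.mem_nhds hxU)
      refine ⟨K, hKc, ?_, fun B hB => hB.mono (Set.inter_subset_inter_right _ hKU)⟩
      refine interior_maximal (s := diamond K) (t := diamond (interior K)) ?_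
        (isOpen_diamond isOpen_interior) ⟨x, hxA, mem_interior_iff_mem_nhds.2 hK⟩
      exact fun B hB => hB.mono (Set.inter_subset_inter_right _ interior_subset)
    choose! K hKc hKA hKS using hK
    refine ⟨⋂ S ∈ f, diamond (K S), ?_, ?_, ?_⟩
    · exact (Filter.biInter_mem hf).2 fun S hS => mem_interior_iff_mem_nhds.1 (hKA S hS)
    · exact fun B hB => hfn fun S hS => hKS S hS (Set.mem_iInter₂.1 hB S hS)
    · rw [isCompact_iff_ultrafilter_le_nhds']
      intro 𝒰 h𝒰
      refine ⟨limit 𝒰, Set.mem_iInter₂.2 fun S hS => ?_, (isTopLimit_limit 𝒰).1⟩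
      exact limit_inter_nonempty (hKc S hS)
        (Filter.mem_of_superset h𝒰 (Set.biInter_subset_of_mem hS))

theorem map_mem_diamond {f : X → Y} {U : Set Y} (hU : IsOpen U)
    (A : LowerVietoris X) : map f A ∈ diamond U ↔ A ∈ diamond (f ⁻¹' U) := by
  constructor
  · rintro ⟨y, hy, hyU⟩
    obtain ⟨_, hU', x, hx, rfl⟩ := mem_closure_iff.1 hy U hU hyU
    exact ⟨x, hx, hU'⟩
  · rintro ⟨x, hx, hxU⟩
    exact ⟨f x, subset_closure ⟨x, hx, rfl⟩, hxU⟩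

theorem continuous_map {f : X → Y} (hf : Continuous f) : Continuous (map f) := by
  refine continuous_generateFrom_iff.2 ?_
  rintro _ ⟨U, hU, rfl⟩
  convert isOpen_diamond (hU.preimage hf) using 1
  ext A
  exact map_mem_diamond hU A

theorem isSpectral_map [StablyCompactSpace X] [hY : StablyCompactSpace Y] {f : X → Y}
    (hf : IsSpectral f) : IsSpectral (map f) := by
  have := hY.locallyCompact
  refine isSpectral_of_isTopLimit (continuous_map hf.continuous) fun 𝒰 => ?_
  refine ⟨limit 𝒰, (isTopLimit_limit 𝒰).1,
    ((continuous_map hf.continuous).tendsto _).comp (isTopLimit_limit 𝒰).1, fun B hB => ?_⟩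
  rw [specializes_iff]
  intro y hy
  by_contra hcon
  obtain ⟨K, hK, hKV, hKc⟩ := local_compact_nhds
    ((map f (limit 𝒰)).2.isOpen_compl.mem_nhds hcon)
  have h1 : map f ⁻¹' diamond (interior K) ∈ 𝒰 := le_nhds_iff.1 hB _ isOpen_interior
    ⟨y, hy, mem_interior_iff_mem_nhds.2 hK⟩
  have h2 : diamond (f ⁻¹' nhdsKer K) ∈ 𝒰 := by
    refine Filter.mem_of_superset h1 fun A hA => ?_
    refine ((map_mem_diamond isOpen_interior A).1 hA).mono ?_
    exact Set.inter_subset_inter_right _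
      (Set.preimage_mono (interior_subset.trans subset_nhdsKer))
  obtain ⟨x, hx, hxK⟩ := limit_inter_nonempty
    (hf.isCompact_preimage _ hKc.nhdsKer (nhdsKer_nhdsKer K)) h2
  exact nhdsKer_minimal hKV (map f (limit 𝒰)).2.isOpen_compl hxK (subset_closure ⟨x, hx, rfl⟩)

theorem map_id (A : LowerVietoris X) : map id A = A :=
  Subtype.ext (by simp [map, A.2.closure_eq])

theorem map_comp {g : Y → Z} (hg : Continuous g) (f : X → Y) (A : LowerVietoris X) :
    map (g ∘ f) A = map g (map f A) :=
  Subtype.ext (by simp only [map, closure_image_closure hg, Set.image_comp])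

end LowerVietoris

end Spaces

/-! ### The category of stably compact spaces and spectral maps -/

/-- The objects of the category of stably compact spaces. -/
structure StablyComp : Type (u + 1) where
  carrier : Type u
  [topologicalSpace : TopologicalSpace carrier]
  [stablyCompactSpace : StablyCompactSpace carrier]

namespace StablyComp

attribute [instance] topologicalSpace stablyCompactSpace

/-- Morphisms of stably compact spaces are the spectral maps. -/
@[ext]
structure Hom (X Y : StablyComp.{u}) : Type u where
  toFun : X.carrier → Y.carrier
  isSpectral : IsSpectral toFun

instance instCategory : Category StablyComp.{u} where
  Hom X Y := Hom X Y
  id X := ⟨id, isSpectral_id⟩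
  comp f g := ⟨g.toFun ∘ f.toFun, g.isSpectral.comp f.isSpectral⟩

/-- The lower Vietoris functor on stably compact spaces. -/
def lowerVietoris : StablyComp.{u} ⥤ StablyComp.{u} where
  obj X := ⟨LowerVietoris X.carrier⟩
  map f := ⟨LowerVietoris.map f.toFun, LowerVietoris.isSpectral_map f.isSpectral⟩
  map_id _ := Hom.ext (funext LowerVietoris.map_id)
  map_comp f g := Hom.ext (funext (LowerVietoris.map_comp g.isSpectral.continuous f.toFun))

/-- The product of two stably compact spaces, with the product topology. -/
def prod (X Y : StablyComp.{u}) : StablyComp.{u} := ⟨X.carrier × Y.carrier⟩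

/-- The coproduct of two stably compact spaces, with the disjoint union topology. -/
def sum (X Y : StablyComp.{u}) : StablyComp.{u} := ⟨X.carrier ⊕ Y.carrier⟩

/-- `prod X Y` together with the two projections. -/
def prodFan (X Y : StablyComp.{u}) : BinaryFan X Y :=
  BinaryFan.mk (P := prod X Y) ⟨Prod.fst, isSpectral_fst⟩ ⟨Prod.snd, isSpectral_snd⟩

/-- `sum X Y` together with the two injections. -/
def sumCofan (X Y : StablyComp.{u}) : BinaryCofan X Y :=
  BinaryCofan.mk (P := sum X Y) ⟨Sum.inl, isSpectral_inl⟩ ⟨Sum.inr, isSpectral_inr⟩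

/-- `prod X Y` is the categorical product. -/
def prodFanIsLimit (X Y : StablyComp.{u}) : IsLimit (prodFan X Y) :=
  BinaryFan.isLimitMk (fun s => ⟨fun z => (s.fst.toFun z, s.snd.toFun z),
      s.fst.isSpectral.prodMk s.snd.isSpectral⟩)
    (fun _ => rfl) (fun _ => rfl) fun _ _ h₁ h₂ => Hom.ext <| funext fun z =>
      Prod.ext (congrFun (congrArg Hom.toFun h₁) z) (congrFun (congrArg Hom.toFun h₂) z)

/-- `sum X Y` is the categorical coproduct. -/
def sumCofanIsColimit (X Y : StablyComp.{u}) : IsColimit (sumCofan X Y) :=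
  BinaryCofan.isColimitMk (fun s => ⟨Sum.elim s.inl.toFun s.inr.toFun,
      s.inl.isSpectral.sumElim s.inr.isSpectral⟩)
    (fun _ => rfl) (fun _ => rfl) fun _ _ h₁ h₂ => Hom.ext <| funext fun z => by
      rcases z with z | z
      exacts [congrFun (congrArg Hom.toFun h₁) z, congrFun (congrArg Hom.toFun h₂) z]

/-- The product functor `F × G`, computed pointwise. -/
def prodFunctor (F G : StablyComp.{u} ⥤ StablyComp.{u}) : StablyComp.{u} ⥤ StablyComp.{u} where
  obj X := prod (F.obj X) (G.obj X)
  map f := ⟨Prod.map (F.map f).toFun (G.map f).toFun,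
    ((F.map f).isSpectral.comp isSpectral_fst).prodMk
      ((G.map f).isSpectral.comp isSpectral_snd)⟩
  map_id X := by rw [F.map_id, G.map_id]; rfl
  map_comp f g := by rw [F.map_comp, G.map_comp]; rfl

/-- The sum functor `F + G`, computed pointwise. -/
def sumFunctor (F G : StablyComp.{u} ⥤ StablyComp.{u}) : StablyComp.{u} ⥤ StablyComp.{u} where
  obj X := sum (F.obj X) (G.obj X)
  map f := ⟨Sum.map (F.map f).toFun (G.map f).toFun,
    (isSpectral_inl.comp (F.map f).isSpectral).sumElim
      (isSpectral_inr.comp (G.map f).isSpectral)⟩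
  map_id X := by rw [F.map_id, G.map_id]; exact Hom.ext Sum.map_id_id
  map_comp f g := by
    rw [F.map_comp, G.map_comp]
    exact Hom.ext (funext (Sum.rec (fun _ => rfl) fun _ => rfl))

/-- The lower Vietoris polynomial functors: the smallest class of endofunctors that contains the
identity, all constant functors and the lower Vietoris functor, and is closed under sums and
products. As sums and products are determined up to isomorphism only, the class is closed under
natural isomorphism. -/
inductive IsLowerVietorisPolynomial : (StablyComp.{u} ⥤ StablyComp.{u}) → Prop
  | id : IsLowerVietorisPolynomial (𝟭 StablyComp.{u})
  | const (A : StablyComp.{u}) : IsLowerVietorisPolynomial ((Functor.const StablyComp.{u}).obj A)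
  | vietoris : IsLowerVietorisPolynomial lowerVietoris
  | sum {F G : StablyComp.{u} ⥤ StablyComp.{u}} :
      IsLowerVietorisPolynomial F → IsLowerVietorisPolynomial G →
        IsLowerVietorisPolynomial (sumFunctor F G)
  | prod {F G : StablyComp.{u} ⥤ StablyComp.{u}} :
      IsLowerVietorisPolynomial F → IsLowerVietorisPolynomial G →
        IsLowerVietorisPolynomial (prodFunctor F G)
  | of_iso {F G : StablyComp.{u} ⥤ StablyComp.{u}} (e : F ≅ G) :
      IsLowerVietorisPolynomial F → IsLowerVietorisPolynomial G

/-- A functor preserves codirected limits if it sends limit cones over diagrams indexed by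
nonempty codirected partially ordered sets (with a morphism `j ⟶ i` iff `j ≤ i`) to limit
cones. -/
def PreservesCodirectedLimits (F : StablyComp.{u} ⥤ StablyComp.{u}) : Prop :=
  ∀ (I : Type u) [PartialOrder I] [Nonempty I] [IsCodirectedOrder I], PreservesLimitsOfShape I F

end StablyComp

/-! Limits over a nonempty codirected poset are computed as for topological spaces. A cone is a
limit in `StablyComp` exactly when every compatible family of points comes from the vertex and the
preimages of open sets along the projections form a basis (`nonempty_isLimit_iff`). Preservation of
such limits thus becomes a concrete check for each functor constructor
(`preservesLimitsOfShape_iff`).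

The tool throughout is the top limit of an ultrafilter, the limit that specializes to all others. It
exists and is unique in a stably compact space, is preserved by spectral maps, and stays inside
closed sets and inside compact saturated sets that belong to the ultrafilter. Top limits can
therefore be formed coordinatewise in the space of compatible families, which makes that space
stably compact and its evaluations spectral.

For the lower Vietoris functor the point condition is the hard one. A compatible family of closed
sets `A i` should come from the intersection of the preimages of the `A i`, so this intersection
must project densely into each `A i`. This is a compactness argument, `exists_section_of_forall_le`:
witnesses chosen at all small indices are pushed forward, and their top limits along an ultrafilter
on the index set form a compatible family. -/

namespace StablyComp

/-! ### Concrete limit cones -/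

section CodirectedLimits

variable {I : Type u} [PartialOrder I]

/-- A cone over a codirected diagram is a limit cone of the underlying topological spaces: the
preimages of open sets under the projections form a basis, and every compatible family of points
comes from a point of the vertex. -/
structure IsConcreteLimit {D : I ⥤ StablyComp.{u}} (c : Cone D) : Prop where
  exists_basic : ∀ (x : c.pt.carrier) (U : Set c.pt.carrier), IsOpen U → x ∈ U →
    ∃ (i : I) (V : Set (D.obj i).carrier), IsOpen V ∧ (c.π.app i).toFun x ∈ V ∧
      (c.π.app i).toFun ⁻¹' V ⊆ U
  exists_point : ∀ x : ∀ i, (D.obj i).carrier,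
    (∀ (i j : I) (f : i ⟶ j), (D.map f).toFun (x i) = x j) →
      ∃ p : c.pt.carrier, ∀ i, (c.π.app i).toFun p = x i

theorem map_comp_apply {J : Type*} [Category J] (D : J ⥤ StablyComp.{u}) {i j k : J} (f : i ⟶ j)
    (g : j ⟶ k) (x : (D.obj i).carrier) :
    (D.map (f ≫ g)).toFun x = (D.map g).toFun ((D.map f).toFun x) :=
  congrFun (congrArg Hom.toFun (D.map_comp f g)) x

theorem cone_w_apply {J : Type*} [Category J] {D : J ⥤ StablyComp.{u}} (c : Cone D) {i j : J}
    (f : i ⟶ j) (x : c.pt.carrier) :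
    (D.map f).toFun ((c.π.app i).toFun x) = (c.π.app j).toFun x :=
  congrFun (congrArg Hom.toFun (c.w f)) x

/-- Two top limits specialize to each other, so T₀ identifies them. This is what makes families of
top limits compatible. -/
theorem eq_of_isTopLimit {X : Type*} [TopologicalSpace X] [h : StablyCompactSpace X]
    {𝒰 : Ultrafilter X} {x y : X} (hx : IsTopLimit 𝒰 x) (hy : IsTopLimit 𝒰 y) : x = y :=
  have := h.t0
  ((hx.2 y hy.1).antisymm (hy.2 x hx.1)).eq

namespace IsConcreteLimit

variable {D : I ⥤ StablyComp.{u}} {c : Cone D}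

/-- Joint injectivity of the projections need not be assumed: the basis condition shows that points
with equal coordinates are inseparable, and the vertex is T₀. -/
theorem ext (hc : IsConcreteLimit c) {x y : c.pt.carrier}
    (h : ∀ i, (c.π.app i).toFun x = (c.π.app i).toFun y) : x = y := by
  have := c.pt.stablyCompactSpace.t0
  have key : ∀ x y : c.pt.carrier, (∀ i, (c.π.app i).toFun x = (c.π.app i).toFun y) → x ⤳ y := by
    intro x y h
    rw [specializes_iff_forall_open]
    intro U hU hy
    obtain ⟨i, V, -, hyV, hVU⟩ := hc.exists_basic y U hU hy
    exact hVU (by simpa [h i] using hyV)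
  exact ((key x y h).antisymm (key y x fun i => (h i).symm)).eq

theorem le_nhds (hc : IsConcreteLimit c) {F : Filter c.pt.carrier} {x : c.pt.carrier}
    (h : ∀ i, F.map (c.π.app i).toFun ≤ 𝓝 ((c.π.app i).toFun x)) : F ≤ 𝓝 x := by
  rw [(nhds_basis_opens x).ge_iff]
  rintro U ⟨hx, hU⟩
  obtain ⟨i, V, hV, hxV, hVU⟩ := hc.exists_basic x U hU hx
  exact Filter.mem_of_superset (h i (hV.mem_nhds hxV)) hVU

theorem isTopLimit (hc : IsConcreteLimit c) {𝒰 : Ultrafilter c.pt.carrier} {x : c.pt.carrier}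
    (h : ∀ i, IsTopLimit (𝒰.map (c.π.app i).toFun) ((c.π.app i).toFun x)) : IsTopLimit 𝒰 x := by
  refine ⟨hc.le_nhds fun i => (h i).1, fun y hy => ?_⟩
  rw [specializes_iff_forall_open]
  intro U hU hyU
  obtain ⟨i, V, hV, hyV, hVU⟩ := hc.exists_basic y U hU hyU
  refine hVU (((h i).2 _ ?_).mem_open hV hyV)
  exact ((c.π.app i).isSpectral.continuous.tendsto y).comp hy

/-- The pointwise lift is continuous because convergence is tested on the projections. It is
spectral because top limits are tested there too, and the legs of the other cone preserve them. -/
theorem isLimit (hc : IsConcreteLimit c) : Nonempty (IsLimit c) := by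
  have hl : ∀ (s : Cone D) (z : s.pt.carrier), ∃ p : c.pt.carrier,
      ∀ i, (c.π.app i).toFun p = (s.π.app i).toFun z := fun s z =>
    hc.exists_point (fun i => (s.π.app i).toFun z) fun i j f => cone_w_apply s f z
  choose l hl using hl
  have hsp : ∀ s, IsSpectral (l s) := by
    intro s
    have hcont : Continuous (l s) := by
      refine continuous_iff_continuousAt.2 fun z => hc.le_nhds fun i => ?_
      rw [Filter.map_map, hl]
      have : (c.π.app i).toFun ∘ l s = (s.π.app i).toFun := funext fun z => hl s z i
      rw [this]
      exact (s.π.app i).isSpectral.continuous.tendsto z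
    refine isSpectral_of_isTopLimit hcont fun 𝒰 => ?_
    obtain ⟨z, hz⟩ := StablyCompactSpace.exists_isTopLimit 𝒰
    refine ⟨z, hz.1, hc.isTopLimit fun i => ?_⟩
    have : (c.π.app i).toFun ∘ l s = (s.π.app i).toFun := funext fun z => hl s z i
    rw [Ultrafilter.map_map, this, hl]
    exact (s.π.app i).isSpectral.isTopLimit_map hz
  exact ⟨{
    lift := fun s => ⟨l s, hsp s⟩
    fac := fun s i => Hom.ext (funext fun z => hl s z i)
    uniq := fun s m hm => Hom.ext (funext fun z => hc.ext fun i =>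
      (congrFun (congrArg Hom.toFun (hm i)) z).trans (hl s z i).symm) }⟩

theorem of_iso (hc : IsConcreteLimit c) {d : Cone D} (e : c ≅ d) : IsConcreteLimit d := by
  have hπ : ∀ i x, (d.π.app i).toFun (e.hom.hom.toFun x) = (c.π.app i).toFun x := fun i x =>
    congrFun (congrArg Hom.toFun (e.hom.w i)) x
  have hπ' : ∀ i x, (c.π.app i).toFun (e.inv.hom.toFun x) = (d.π.app i).toFun x := fun i x =>
    congrFun (congrArg Hom.toFun (e.inv.w i)) x
  have hid : ∀ x, e.hom.hom.toFun (e.inv.hom.toFun x) = x := fun x =>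
    congrFun (congrArg Hom.toFun (congrArg ConeMorphism.hom e.inv_hom_id)) x
  refine ⟨fun x U hU hx => ?_, fun x hx => ?_⟩
  · obtain ⟨i, V, hV, hxV, hVU⟩ := hc.exists_basic (e.inv.hom.toFun x) (e.hom.hom.toFun ⁻¹' U)
      (hU.preimage e.hom.hom.isSpectral.continuous) (by simpa [hid] using hx)
    refine ⟨i, V, hV, by simpa [hπ'] using hxV, fun y hy => ?_⟩
    have : e.inv.hom.toFun y ∈ e.hom.hom.toFun ⁻¹' U := hVU (by simpa [hπ'] using hy)
    simpa [hid] using this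
  · obtain ⟨p, hp⟩ := hc.exists_point x hx
    exact ⟨e.hom.hom.toFun p, fun i => (hπ i p).trans (hp i)⟩

end IsConcreteLimit

/-! ### The space of compatible families -/

/-- The compatible families of points of a diagram of stably compact spaces. -/
def Sections (D : I ⥤ StablyComp.{u}) : Type u :=
  {x : ∀ i, (D.obj i).carrier // ∀ (i j : I) (f : i ⟶ j), (D.map f).toFun (x i) = x j}

namespace Sections

variable (D : I ⥤ StablyComp.{u})

instance instTopologicalSpace : TopologicalSpace (Sections D) :=
  inferInstanceAs (TopologicalSpace (Subtype _))

theorem continuous_eval (i : I) : Continuous fun x : Sections D => x.1 i :=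
  (continuous_apply i).comp continuous_subtype_val

variable {D}

theorem le_nhds_iff {F : Filter (Sections D)} {x : Sections D} :
    F ≤ 𝓝 x ↔ ∀ i, F.map (fun y => y.1 i) ≤ 𝓝 (x.1 i) := by
  have h1 : F ≤ 𝓝 x ↔ Filter.Tendsto (fun y : Sections D => y.1) F (𝓝 x.1) :=
    IsInducing.tendsto_nhds_iff (f := id) IsInducing.subtypeVal
  rw [h1, tendsto_pi_nhds]
  rfl

theorem isTopLimit {𝒰 : Ultrafilter (Sections D)} {x : Sections D}
    (h : ∀ i, IsTopLimit (𝒰.map fun y => y.1 i) (x.1 i)) : IsTopLimit 𝒰 x := by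
  refine ⟨le_nhds_iff.2 fun i => (h i).1, fun y hy => ?_⟩
  rw [specializes_iff_pure, le_nhds_iff]
  intro i
  rw [Filter.map_pure, ← specializes_iff_pure]
  exact (h i).2 _ (le_nhds_iff.1 hy i)

/-- The coordinatewise top limits are compatible: a transition map, being spectral, sends the top
limit at `i` to a top limit at `j`, and that one is unique. -/
theorem exists_isTopLimit (𝒰 : Ultrafilter (Sections D)) :
    ∃ x : Sections D, ∀ i, IsTopLimit (𝒰.map fun y => y.1 i) (x.1 i) := by
  choose x hx using fun i => StablyCompactSpace.exists_isTopLimit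
    (𝒰.map fun y : Sections D => y.1 i)
  refine ⟨⟨x, fun i j f => eq_of_isTopLimit (𝒰 := 𝒰.map fun y => y.1 j) ?_ (hx j)⟩, hx⟩
  have := (D.map f).isSpectral.isTopLimit_map (hx i)
  rw [Ultrafilter.map_map] at this
  convert this using 2
  exact funext fun y => (y.2 i j f).symm

/-- A basic open set of the product restricts finitely many coordinates. A common lower bound `k` of
their indices turns these into one condition at `k`. -/
theorem exists_basic [Nonempty I] [IsCodirectedOrder I] (x : Sections D) {n : Set (Sections D)}
    (hn : n ∈ 𝓝 x) : ∃ (i : I) (V : Set (D.obj i).carrier), IsOpen V ∧ x.1 i ∈ V ∧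
      (fun y : Sections D => y.1 i) ⁻¹' V ⊆ n := by
  have h𝓝 : 𝓝 x = Filter.comap Subtype.val (𝓝 x.1) := IsInducing.subtypeVal.nhds_eq_comap x
  obtain ⟨t, ht, htn⟩ := Filter.mem_comap.1 (h𝓝 ▸ hn)
  rw [nhds_pi, Filter.mem_pi] at ht
  obtain ⟨s, hs, W, hW, hWt⟩ := ht
  obtain ⟨k, hk⟩ := hs.bddBelow
  -- The inner intersection over proofs of `k ≤ i` only makes the transition map available; for `i ∈
  -- s` such a proof exists.
  have hop : (⋂ i ∈ s, ⋂ h : k ≤ i, (D.map (homOfLE h)).toFun ⁻¹' interior (W i)) ∈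
      𝓝 (x.1 k) := by
    refine (Filter.biInter_mem hs).2 fun i hi => Filter.iInter_mem.2 fun h => ?_
    refine (D.map (homOfLE h)).isSpectral.continuous.continuousAt ?_
    rw [x.2, interior_mem_nhds]
    exact hW i
  obtain ⟨V, hVs, hV, hxV⟩ := mem_nhds_iff.1 hop
  refine ⟨k, V, hV, hxV, fun y hy => htn (hWt fun i hi => ?_)⟩
  have := Set.mem_iInter.1 (Set.mem_iInter₂.1 (hVs hy) i hi) (hk hi)
  rw [Set.mem_preimage, y.2] at this
  exact interior_subset this

instance instStablyCompactSpace [Nonempty I] [IsCodirectedOrder I] :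
    StablyCompactSpace (Sections D) := by
  refine stablyCompactSpace_of_isTopLimit ?_ ⟨fun x n hn => ?_⟩ fun 𝒰 =>
    (exists_isTopLimit 𝒰).imp fun x hx => isTopLimit hx
  · have := fun i => (D.obj i).stablyCompactSpace.t0
    exact inferInstanceAs (T0Space (Subtype _))
  · obtain ⟨i, V, hV, hxV, hVn⟩ := exists_basic x hn
    have := (D.obj i).stablyCompactSpace.locallyCompact
    obtain ⟨K, hK, hKV, hKc⟩ := local_compact_nhds (hV.mem_nhds hxV)
    -- Saturating `K` keeps it compact and inside `V`, and lets the top limit of an ultrafilter on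
    -- the preimage stay in it.
    refine ⟨(fun y : Sections D => y.1 i) ⁻¹' nhdsKer K,
      (continuous_eval D i).continuousAt (Filter.mem_of_superset hK subset_nhdsKer),
      (Set.preimage_mono (nhdsKer_minimal hKV hV)).trans hVn, ?_⟩
    rw [isCompact_iff_ultrafilter_le_nhds']
    intro 𝒰 h𝒰
    obtain ⟨y, hy⟩ := exists_isTopLimit 𝒰
    exact ⟨y, (hy i).mem hKc.nhdsKer (nhdsKer_nhdsKer K) h𝒰, (isTopLimit hy).1⟩

theorem isSpectral_eval [Nonempty I] [IsCodirectedOrder I] (i : I) :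
    IsSpectral fun x : Sections D => x.1 i := by
  refine isSpectral_of_isTopLimit (continuous_eval D i) fun 𝒰 => ?_
  obtain ⟨x, hx⟩ := exists_isTopLimit 𝒰
  exact ⟨x, (isTopLimit hx).1, hx i⟩

variable (D) in
/-- The cone with vertex the space of compatible families. -/
def cone [Nonempty I] [IsCodirectedOrder I] : Cone D where
  pt := ⟨Sections D⟩
  π :=
    { app := fun i => ⟨fun x : Sections D => x.1 i, isSpectral_eval i⟩
      naturality := fun i j f => Hom.ext (funext fun x : Sections D => (x.2 i j f).symm) }

variable (D) in
theorem isConcreteLimit_cone [Nonempty I] [IsCodirectedOrder I] : IsConcreteLimit (cone D) :=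
  ⟨fun x _ hU hx => exists_basic (D := D) x (hU.mem_nhds hx), fun x hx => ⟨⟨x, hx⟩, fun _ => rfl⟩⟩

end Sections

/-- The cone of compatible families is concrete, hence a limit; any other limit cone is isomorphic
to it and inherits concreteness. -/
theorem nonempty_isLimit_iff [Nonempty I] [IsCodirectedOrder I] {D : I ⥤ StablyComp.{u}}
    {c : Cone D} : Nonempty (IsLimit c) ↔ IsConcreteLimit c := by
  refine ⟨fun ⟨h⟩ => ?_, IsConcreteLimit.isLimit⟩
  obtain ⟨h'⟩ := (Sections.isConcreteLimit_cone D).isLimit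
  exact (Sections.isConcreteLimit_cone D).of_iso (h'.uniqueUpToIso h)

theorem preservesLimitsOfShape_iff [Nonempty I] [IsCodirectedOrder I]
    {F : StablyComp.{u} ⥤ StablyComp.{u}} :
    PreservesLimitsOfShape I F ↔ ∀ (D : I ⥤ StablyComp.{u}) (c : Cone D),
      IsConcreteLimit c → IsConcreteLimit (F.mapCone c) := by
  refine ⟨fun h D c hc => ?_, fun h => ⟨⟨fun {c} hc => ?_⟩⟩⟩
  · obtain ⟨hc⟩ := hc.isLimit
    exact nonempty_isLimit_iff.1 ⟨isLimitOfPreserves F hc⟩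
  · exact (h _ c (nonempty_isLimit_iff.1 ⟨hc⟩)).isLimit

/-! ### Constant functors, products and sums -/

/-- All transition maps and projections are identities, so compatible families are constant: any two
indices have a common lower bound. -/
theorem isConcreteLimit_const [Nonempty I] [IsCodirectedOrder I] (A : StablyComp.{u})
    {D : I ⥤ StablyComp.{u}} (c : Cone D) :
    IsConcreteLimit (((Functor.const StablyComp.{u}).obj A).mapCone c) := by
  obtain ⟨i⟩ := ‹Nonempty I›
  refine ⟨fun x U hU hx => ⟨i, U, hU, hx, subset_rfl⟩, fun x hx => ⟨x i, fun j => ?_⟩⟩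
  obtain ⟨k, hki, hkj⟩ := exists_le_le i j
  exact (hx k i (homOfLE hki)).symm.trans (hx k j (homOfLE hkj))

theorem IsConcreteLimit.prod [IsCodirectedOrder I] {F G : StablyComp.{u} ⥤ StablyComp.{u}}
    {D : I ⥤ StablyComp.{u}} {c : Cone D} (hF : IsConcreteLimit (F.mapCone c))
    (hG : IsConcreteLimit (G.mapCone c)) : IsConcreteLimit ((prodFunctor F G).mapCone c) := by
  refine ⟨?_, fun x hx => ?_⟩
  · rintro ⟨x, y⟩ U hU hxy
    obtain ⟨U₁, U₂, hU₁, hU₂, hx, hy, hsub⟩ := isOpen_prod_iff.1 hU x y hxy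
    obtain ⟨i, V, hV, hxV, hVU⟩ := hF.exists_basic x U₁ hU₁ hx
    obtain ⟨j, W, hW, hyW, hWU⟩ := hG.exists_basic y U₂ hU₂ hy
    obtain ⟨k, hki, hkj⟩ := exists_le_le i j
    have e₁ : ∀ z, ((D ⋙ F).map (homOfLE hki)).toFun (((F.mapCone c).π.app k).toFun z) =
      ((F.mapCone c).π.app i).toFun z := cone_w_apply (F.mapCone c) (homOfLE hki)
    have e₂ : ∀ z, ((D ⋙ G).map (homOfLE hkj)).toFun (((G.mapCone c).π.app k).toFun z) =
      ((G.mapCone c).π.app j).toFun z := cone_w_apply (G.mapCone c) (homOfLE hkj)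
    refine ⟨k, (((D ⋙ F).map (homOfLE hki)).toFun ⁻¹' V) ×ˢ
      (((D ⋙ G).map (homOfLE hkj)).toFun ⁻¹' W), ?_, ⟨?_, ?_⟩, ?_⟩
    · exact (hV.preimage ((D ⋙ F).map (homOfLE hki)).isSpectral.continuous).prod
        (hW.preimage ((D ⋙ G).map (homOfLE hkj)).isSpectral.continuous)
    · exact (Set.mem_of_eq_of_mem (e₁ x) hxV :)
    · exact (Set.mem_of_eq_of_mem (e₂ y) hyW :)
    · rintro ⟨a, b⟩ ⟨ha, hb⟩
      exact hsub ⟨hVU (Set.mem_of_eq_of_mem (e₁ a).symm ha :),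
        hWU (Set.mem_of_eq_of_mem (e₂ b).symm hb :)⟩
  · obtain ⟨p, hp⟩ := hF.exists_point (fun i => (x i).1) fun i j f => congrArg Prod.fst (hx i j f)
    obtain ⟨q, hq⟩ := hG.exists_point (fun i => (x i).2) fun i j f => congrArg Prod.snd (hx i j f)
    exact ⟨(p, q), fun i => Prod.ext (hp i) (hq i)⟩

theorem IsConcreteLimit.sum [Nonempty I] [IsCodirectedOrder I]
    {F G : StablyComp.{u} ⥤ StablyComp.{u}} {D : I ⥤ StablyComp.{u}} {c : Cone D}
    (hF : IsConcreteLimit (F.mapCone c)) (hG : IsConcreteLimit (G.mapCone c)) :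
    IsConcreteLimit ((sumFunctor F G).mapCone c) := by
  refine ⟨?_, fun x hx => ?_⟩
  · rintro (x | x) U hU hxU
    · obtain ⟨i, V, hV, hxV, hVU⟩ := hF.exists_basic x _ (isOpen_sum_iff.1 hU).1 hxU
      refine ⟨i, Sum.inl '' V, isOpenMap_inl _ hV, ⟨_, hxV, rfl⟩, ?_⟩
      rintro (y | y) ⟨v, hv, h⟩
      · exact hVU (Set.mem_of_eq_of_mem (Sum.inl_injective h).symm hv :)
      · cases h
    · obtain ⟨i, V, hV, hxV, hVU⟩ := hG.exists_basic x _ (isOpen_sum_iff.1 hU).2 hxU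
      refine ⟨i, Sum.inr '' V, isOpenMap_inr _ hV, ⟨_, hxV, rfl⟩, ?_⟩
      rintro (y | y) ⟨v, hv, h⟩
      · cases h
      · exact hVU (Set.mem_of_eq_of_mem (Sum.inr_injective h).symm hv :)
  · obtain ⟨i⟩ := ‹Nonempty I›
    have hmap : ∀ (j k : I) (f : j ⟶ k),
        Sum.map ((D ⋙ F).map f).toFun ((D ⋙ G).map f).toFun (x j) = x k := hx
    rcases hi : x i with a | a
    -- Transition maps respect the two summands, so `x i` and `x j` both lie in the summand of `x k`
    -- for a common lower bound `k`.
    · have hall : ∀ j, ∃ b, x j = Sum.inl b := by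
        intro j
        obtain ⟨k, hki, hkj⟩ := exists_le_le i j
        have h₁ := hmap k i (homOfLE hki)
        have h₂ := hmap k j (homOfLE hkj)
        rcases hk : x k with b | b <;> rw [hk] at h₁ h₂
        · exact ⟨_, h₂.symm⟩
        · cases h₁.trans hi
      choose y hy using hall
      obtain ⟨p, hp⟩ := hF.exists_point y fun j k f => by
        have := hmap j k f
        rw [hy, hy] at this
        exact Sum.inl_injective this
      exact ⟨Sum.inl p, fun j => (congrArg Sum.inl (hp j)).trans (hy j).symm⟩
    · have hall : ∀ j, ∃ b, x j = Sum.inr b := by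
        intro j
        obtain ⟨k, hki, hkj⟩ := exists_le_le i j
        have h₁ := hmap k i (homOfLE hki)
        have h₂ := hmap k j (homOfLE hkj)
        rcases hk : x k with b | b <;> rw [hk] at h₁ h₂
        · cases h₁.trans hi
        · exact ⟨_, h₂.symm⟩
      choose y hy using hall
      obtain ⟨p, hp⟩ := hG.exists_point y fun j k f => by
        have := hmap j k f
        rw [hy, hy] at this
        exact Sum.inr_injective this
      exact ⟨Sum.inr p, fun j => (congrArg Sum.inr (hp j)).trans (hy j).symm⟩

/-! ### The lower Vietoris functor -/

/-- A form of the fact that codirected limits of nonempty compact sets are nonempty, applied to the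
parts of the `A j` lying over `K`. The point at `k` is the top limit of the images of the chosen
witnesses as their index descends. -/
theorem exists_section_of_forall_le [Nonempty I] [IsCodirectedOrder I] (D : I ⥤ StablyComp.{u})
    {A : ∀ i, Set (D.obj i).carrier} (hA : ∀ i, IsClosed (A i))
    (hmap : ∀ (i j : I) (f : i ⟶ j), Set.MapsTo (D.map f).toFun (A i) (A j)) {i : I}
    {K : Set (D.obj i).carrier} (hK : IsCompact K) (hKs : IsSaturated K)
    (h : ∀ (j : I) (f : j ⟶ i), ∃ z ∈ A j, (D.map f).toFun z ∈ K) :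
    ∃ x : ∀ j, (D.obj j).carrier, (∀ (j k : I) (f : j ⟶ k), (D.map f).toFun (x j) = x k) ∧
      (∀ j, x j ∈ A j) ∧ x i ∈ K := by
  classical
  have hne : ∀ j, ∃ z : (D.obj j).carrier, ∀ f : j ⟶ i, z ∈ A j ∧ (D.map f).toFun z ∈ K := by
    intro j
    by_cases hji : j ≤ i
    · obtain ⟨z, hz, hzK⟩ := h j (homOfLE hji)
      exact ⟨z, fun f => ⟨hz, hzK⟩⟩
    -- Off the indices below `i` any point will do; the image of a witness from a common lower bound
    -- shows that one exists.
    · obtain ⟨k, hki, hkj⟩ := exists_le_le i j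
      obtain ⟨z, -, -⟩ := h k (homOfLE hki)
      exact ⟨(D.map (homOfLE hkj)).toFun z, fun f => (hji f.le).elim⟩
  choose z hz using hne
  -- Codirectedness makes `atBot` proper, so some ultrafilter contains every down-set.
  let 𝒲 : Ultrafilter I := Ultrafilter.of Filter.atBot
  have h𝒲 : ∀ k, ∀ᶠ j in (𝒲 : Filter I), j ≤ k := fun k =>
    Ultrafilter.of_le _ (Filter.eventually_le_atBot k)
  -- The value `z k` is a filler: `𝒲`-almost all `j` satisfy `j ≤ k`.
  let t : ∀ k, I → (D.obj k).carrier := fun k j =>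
    if hjk : j ≤ k then (D.map (homOfLE hjk)).toFun (z j) else z k
  have ht : ∀ {j k : I} (f : j ⟶ k), t k j = (D.map f).toFun (z j) := fun f => dif_pos f.le
  choose x hx using fun k => StablyCompactSpace.exists_isTopLimit (𝒲.map (t k))
  refine ⟨x, fun j k f => eq_of_isTopLimit ?_ (hx k), fun k => ?_, ?_⟩
  · have := (D.map f).isSpectral.isTopLimit_map (hx j)
    convert this using 1
    refine Ultrafilter.coe_injective ?_
    rw [Ultrafilter.map_map, Ultrafilter.coe_map, Ultrafilter.coe_map]
    refine Filter.map_congr ?_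
    filter_upwards [h𝒲 j] with l hl
    rw [Function.comp_apply, ht (homOfLE hl), ← map_comp_apply]
    exact ht _
  · refine (hA k).mem_of_tendsto (b := (𝒲 : Filter I)) (f := t k) (hx k).1 ?_
    filter_upwards [h𝒲 k, h𝒲 i] with l hl hli
    rw [ht (homOfLE hl)]
    exact hmap _ _ _ (hz l (homOfLE hli)).1
  · refine (hx i).mem hK hKs ?_
    change ∀ᶠ l in (𝒲 : Filter I), t i l ∈ K
    filter_upwards [h𝒲 i] with l hl
    rw [ht (homOfLE hl)]
    exact (hz l (homOfLE hl)).2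

theorem IsConcreteLimit.lowerVietoris [Nonempty I] [IsCodirectedOrder I]
    {D : I ⥤ StablyComp.{u}} {c : Cone D} (hc : IsConcreteLimit c) :
    IsConcreteLimit (lowerVietoris.mapCone c) := by
  refine ⟨fun A 𝒪 h𝒪 hA => ?_, fun A hA => ?_⟩
  · change LowerVietoris c.pt.carrier at A
    obtain ⟨_, ⟨f, ⟨hf, hfs⟩, rfl⟩, hAf, hf𝒪⟩ :=
      (TopologicalSpace.isTopologicalBasis_of_subbasis rfl).mem_nhds_iff.1 (h𝒪.mem_nhds hA)
    have hS : ∀ S ∈ f, ∃ (i : I) (V : Set (D.obj i).carrier), IsOpen V ∧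
        LowerVietoris.map (c.π.app i).toFun A ∈ LowerVietoris.diamond V ∧
        LowerVietoris.map (c.π.app i).toFun ⁻¹' LowerVietoris.diamond V ⊆ S := by
      intro S hS
      obtain ⟨U, hU, rfl⟩ := hfs hS
      obtain ⟨x, hxA, hxU⟩ := hAf _ hS
      obtain ⟨i, V, hV, hxV, hVU⟩ := hc.exists_basic x U hU hxU
      refine ⟨i, V, hV, (LowerVietoris.map_mem_diamond hV A).2 ⟨x, hxA, hxV⟩, fun B hB => ?_⟩
      exact ((LowerVietoris.map_mem_diamond hV B).1 hB).mono (Set.inter_subset_inter_right _ hVU)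
    choose! i V hV hAV hVS using hS
    obtain ⟨k, hk⟩ := (hf.image i).bddBelow
    have hk' : ∀ S ∈ f, k ≤ i S := fun S hS => hk ⟨S, hS, rfl⟩
    have e : ∀ S (h : k ≤ i S) (B : LowerVietoris c.pt.carrier),
        LowerVietoris.map (D.map (homOfLE h)).toFun (LowerVietoris.map (c.π.app k).toFun B) =
          LowerVietoris.map (c.π.app (i S)).toFun B := fun S h B =>
      cone_w_apply (StablyComp.lowerVietoris.mapCone c) (homOfLE h) B
    refine ⟨k, ⋂ S ∈ f, ⋂ h : k ≤ i S,
      LowerVietoris.map (D.map (homOfLE h)).toFun ⁻¹' LowerVietoris.diamond (V S), ?_, ?_, ?_⟩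
    · refine hf.isOpen_biInter fun S hS => isOpen_iInter_of_finite fun h => ?_
      exact (LowerVietoris.isOpen_diamond (hV S hS)).preimage
        (LowerVietoris.continuous_map (D.map (homOfLE h)).isSpectral.continuous)
    · refine Set.mem_iInter₂.2 fun S hS => Set.mem_iInter.2 fun h => ?_
      exact (Set.mem_of_eq_of_mem (e S h A) (hAV S hS) :)
    · refine fun B hB => hf𝒪 fun S hS => hVS S hS ?_
      have := Set.mem_iInter.1 (Set.mem_iInter₂.1 hB S hS) (hk' S hS)
      exact (Set.mem_of_eq_of_mem (e S (hk' S hS) B).symm this :)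
  · change ∀ i, LowerVietoris (D.obj i).carrier at A
    have hA' : ∀ (i j : I) (f : i ⟶ j), LowerVietoris.map (D.map f).toFun (A i) = A j := hA
    -- The largest candidate: every closed set projecting into all the `A i` lies in it.
    let B : LowerVietoris c.pt.carrier := ⟨⋂ i, {x | (c.π.app i).toFun x ∈ (A i).1},
      isClosed_iInter fun i => (A i).2.preimage (c.π.app i).isSpectral.continuous⟩
    refine ⟨B, fun i => Subtype.ext (Set.Subset.antisymm ?_ fun y hy => ?_)⟩
    · refine closure_minimal (Set.image_subset_iff.2 ?_) (A i).2
      exact fun x hx => Set.mem_iInter.1 hx i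
    · refine mem_closure_iff.2 fun U hU hyU => ?_
      have := (D.obj i).stablyCompactSpace.locallyCompact
      obtain ⟨K, hK, hKU, hKc⟩ := local_compact_nhds (hU.mem_nhds hyU)
      -- The image of `A j` is dense in `A i`, so it meets the interior of `K`, a neighbourhood of
      -- `y`. This gives a witness at every `j` below `i`.
      obtain ⟨x, hx, hxA, hxK⟩ := exists_section_of_forall_le D (fun j => (A j).2)
        (fun j k f a ha => by
          rw [← hA' j k f]
          exact subset_closure ⟨a, ha, rfl⟩) hKc.nhdsKer (nhdsKer_nhdsKer K) fun j f => by
        have hmem : LowerVietoris.map (D.map f).toFun (A j) ∈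
            LowerVietoris.diamond (interior K) := by
          rw [hA']
          exact ⟨y, hy, mem_interior_iff_mem_nhds.2 hK⟩
        obtain ⟨z, hz, hzK⟩ := (LowerVietoris.map_mem_diamond isOpen_interior (A j)).1 hmem
        exact ⟨z, hz, subset_nhdsKer (interior_subset hzK)⟩
      obtain ⟨p, hp⟩ := hc.exists_point x hx
      refine ⟨x i, nhdsKer_minimal hKU hU hxK, p, Set.mem_iInter.2 fun j => ?_, hp i⟩
      exact (Set.mem_of_eq_of_mem (hp j) (hxA j) :)

end CodirectedLimits

/-! ### The theorem, by induction on polynomial functors -/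

theorem preservesCodirectedLimits_lowerVietoris :
    PreservesCodirectedLimits lowerVietoris.{u} := fun _ _ _ _ =>
  preservesLimitsOfShape_iff.2 fun _ _ hc => hc.lowerVietoris

theorem IsLowerVietorisPolynomial.preservesCodirectedLimits {F : StablyComp.{u} ⥤ StablyComp.{u}}
    (hF : IsLowerVietorisPolynomial F) : PreservesCodirectedLimits F := by
  induction hF with
  | id => exact fun I _ _ _ => inferInstance
  | const A => exact fun I _ _ _ => preservesLimitsOfShape_iff.2 fun _ c _ =>
      isConcreteLimit_const A c
  | vietoris => exact preservesCodirectedLimits_lowerVietoris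
  | sum _ _ hF hG =>
    intro I _ _ _
    exact preservesLimitsOfShape_iff.2 fun D c hc =>
      .sum (preservesLimitsOfShape_iff.1 (hF I) D c hc)
        (preservesLimitsOfShape_iff.1 (hG I) D c hc)
  | prod _ _ hF hG =>
    intro I _ _ _
    exact preservesLimitsOfShape_iff.2 fun D c hc =>
      .prod (preservesLimitsOfShape_iff.1 (hF I) D c hc)
        (preservesLimitsOfShape_iff.1 (hG I) D c hc)
  | of_iso e _ hF => exact fun I _ _ _ =>
      have := hF I
      preservesLimitsOfShape_of_natIso e

end StablyComp

theorem mainTheorem4 :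
    StablyComp.PreservesCodirectedLimits StablyComp.lowerVietoris.{u} ∧
      ∀ F : StablyComp.{u} ⥤ StablyComp.{u}, StablyComp.IsLowerVietorisPolynomial F →
        StablyComp.PreservesCodirectedLimits F :=
  ⟨StablyComp.preservesCodirectedLimits_lowerVietoris,
    fun _ hF => hF.preservesCodirectedLimits⟩
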